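/- Let $\mathbb F_{64}$ be the field with $64$ elements and $\mathbb F_8=\{x\in\mathbb F_{64}: x^8=x\}$ its subfield with $8$ elements. Let $\epsilon$ be a generator of the cyclic group $\mathbb F_{64}^\times$, and let $N=P(\epsilon)$ be the group with underlying set $\mathbb F_{64}\times\mathbb F_8$ and multiplication $$(a,x)(b,y)=(a+b,\;x+y+ab^2\epsilon+a^8b^{16}\epsilon^8).$$ Then $N$ has order $2^9$ and is an AT-group, i.e. for any two elements $x,y\in N$ of the same order there is $\alpha\in\mathrm{Aut}(N)$ with $\alpha(x)=y$. Moreover $\mathrm{Aut}(N)\cong 2^{18}{:}(7{:}9)$, i.e. $\mathrm{Aut}(N)$ is isomorphic to a semidirect product $E\rtimes_\varphi H$ for some homomorphism $\varphi:H\to\mathrm{Aut}(E)$, where $E=(\mathbb Z/2)^{18}$ and $H=7{:}9$ is the non-abelian semidirect product $\mathbb Z/7\rtimes\mathbb Z/9$ in which a generator of $\mathbb Z/9$ acts on $\mathbb Z/7$ as multiplication by $2$. -/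

import Mathlib

/-- The field with `64` elements. -/
abbrev F64 : Type := GaloisField 2 6

/-- The subfield with `8` elements of the field with `64` elements: all `x` with `x ^ 8 = x`. -/
noncomputable def F8 : Subfield F64 :=
  (iterateFrobenius F64 2 3).eqLocusField (RingHom.id F64)

theorem mem_F8_iff (x : F64) : x ∈ F8 ↔ x ^ 8 = x := by
  unfold F8
  rw [RingHom.mem_eqLocusField, iterateFrobenius_def]
  simp

theorem F64.pow_card (x : F64) : x ^ 64 = x := by
  have : Fintype F64 := Fintype.ofFinite F64
  have h : Fintype.card F64 = 64 := by
    rw [← Nat.card_eq_fintype_card, GaloisField.card 2 6 (by norm_num)]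
    norm_num
  rw [← h]
  exact FiniteField.pow_card x

theorem F64.add_pow_two (x y : F64) : (x + y) ^ 2 = x ^ 2 + y ^ 2 := add_pow_char x y 2

theorem F64.add_pow_eight (x y : F64) : (x + y) ^ 8 = x ^ 8 + y ^ 8 :=
  add_pow_char_pow x y 2 3

theorem F64.add_pow_sixteen (x y : F64) : (x + y) ^ 16 = x ^ 16 + y ^ 16 :=
  add_pow_char_pow x y 2 4

theorem cocycle_mem_F8 (ε a b : F64) :
    a * b ^ 2 * ε + a ^ 8 * b ^ 16 * ε ^ 8 ∈ F8 := by
  rw [mem_F8_iff, F64.add_pow_eight]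
  have h : (a ^ 8 * b ^ 16 * ε ^ 8) ^ 8 = a ^ 64 * (b ^ 64) ^ 2 * ε ^ 64 := by ring
  rw [h, F64.pow_card, F64.pow_card, F64.pow_card]
  ring

/-- The element `a b² ε + a⁸ b¹⁶ ε⁸` of the field with `8` elements. -/
noncomputable def cocycle (ε a b : F64) : F8 :=
  ⟨a * b ^ 2 * ε + a ^ 8 * b ^ 16 * ε ^ 8, cocycle_mem_F8 ε a b⟩

theorem cocycle_assoc (ε a b c : F64) :
    cocycle ε a b + cocycle ε (a + b) c = cocycle ε b c + cocycle ε a (b + c) := by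
  apply Subtype.ext
  simp only [cocycle, Subfield.coe_add, F64.add_pow_two, F64.add_pow_eight, F64.add_pow_sixteen]
  ring

/-- The underlying set `𝔽₆₄ × 𝔽₈` of the group `P(ε)`. -/
@[ext]
structure PGroup (ε : F64) : Type where
  /-- the coordinate in the field with `64` elements -/
  fst : F64
  /-- the coordinate in the field with `8` elements -/
  snd : F8

/-- The group structure of `P(ε)`:
`(a, x) (b, y) = (a + b, x + y + a b² ε + a⁸ b¹⁶ ε⁸)`. -/
noncomputable instance PGroup.instGroup (ε : F64) : Group (PGroup ε) where
  mul p q := ⟨p.fst + q.fst, p.snd + q.snd + cocycle ε p.fst q.fst⟩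
  one := ⟨0, 0⟩
  inv p := ⟨-p.fst, -p.snd - cocycle ε (-p.fst) p.fst⟩
  mul_assoc p q r := by
    apply PGroup.ext
    · exact add_assoc _ _ _
    · change p.snd + q.snd + cocycle ε p.fst q.fst + r.snd + cocycle ε (p.fst + q.fst) r.fst
        = p.snd + (q.snd + r.snd + cocycle ε q.fst r.fst) + cocycle ε p.fst (q.fst + r.fst)
      linear_combination cocycle_assoc ε p.fst q.fst r.fst
  one_mul p := by
    apply PGroup.ext
    · exact zero_add _
    · apply Subtype.ext
      change ((0 + p.snd + cocycle ε 0 p.fst : F8) : F64) = p.snd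
      simp [cocycle]
  mul_one p := by
    apply PGroup.ext
    · exact add_zero _
    · apply Subtype.ext
      change ((p.snd + 0 + cocycle ε p.fst 0 : F8) : F64) = p.snd
      simp [cocycle]
  inv_mul_cancel p := by
    apply PGroup.ext
    · exact neg_add_cancel _
    · change -p.snd - cocycle ε (-p.fst) p.fst + p.snd + cocycle ε (-p.fst) p.fst = 0
      ring

/-- An AT-group: any two elements of the same order are fused by an automorphism. -/
def IsATGroup (N : Type*) [Group N] : Prop :=
  ∀ x y : N, orderOf x = orderOf y → ∃ α : MulAut N, α x = y

/-- The elementary abelian group `2^n` of order `2 ^ n`, written multiplicatively. -/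
abbrev ElemAbelTwo (n : ℕ) : Type := Multiplicative (Fin n → ZMod 2)

/-- The homomorphism from the cyclic group of order `9` to the units of `ℤ/7` with
`k ↦ 2 ^ k`; its image has order `3`. -/
def unitsHom : Multiplicative (ZMod 9) →* (ZMod 7)ˣ where
  toFun k := (⟨2, 4, by decide, by decide⟩ : (ZMod 7)ˣ) ^ (Multiplicative.toAdd k).val
  map_one' := by decide
  map_mul' := by decide

/-- The action of the cyclic group of order `9` on the cyclic group of order `7` in which a
generator acts by squaring. -/
def actNineOnSeven : Multiplicative (ZMod 9) →* MulAut (Multiplicative (ZMod 7)) where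
  toFun k := AddEquiv.toMultiplicative
    (DistribMulAction.toAddEquiv (ZMod 7) (unitsHom k))
  map_one' := by
    ext x
    simp
  map_mul' k l := by
    ext x
    simp [mul_smul]

/-- The non-abelian split extension `7:9` of order `63` with a cyclic complement of order `9`. It
is unique up to isomorphism. -/
abbrev SevenNine : Type :=
  Multiplicative (ZMod 7) ⋊[actNineOnSeven] Multiplicative (ZMod 9)

/-! Squaring sends `(a, x)` to `(0, q(a))`, where `q(a)` is the trace from `F64` to `F8` of `ε * a ^
3`. Since `ε` is not a cube times an element of trace zero, `q` vanishes only at 0. Hence the pairs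
`(0, x)` are exactly the elements of order at most 2, and `Aut` acts additively on the first
coordinate (`fstHom`). As `q` is onto, the kernel of this action consists of the maps `(a, x) ↦ (a,
x + f a)`, that is, of `Hom(F64, F8)`, elementary abelian of rank 6 · 3 = 18. Scalars from `F8` and
the semilinear map `a ↦ ε * a ^ 4` generate a group `7:9` that is regular on the 63 nonzero first
coordinates (`exists_sevenNineHom_eq`, `eq_one_of_sevenNineHom_eq`). It complements the kernel as
soon as the stabilizer of one nonzero vector acts trivially. That rigidity is `eq_self_of_sqMap`:
after rescaling, `ε` becomes a primitive ninth root of unity `θ`, and a finite check in binary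
coordinates decides. Fusion of elements of equal order follows from the same transitivity, central
automorphisms and scalars. -/

theorem F64.natCard : Nat.card F64 = 64 := by
  rw [GaloisField.card 2 6 (by norm_num)]
  norm_num

theorem F64.two_eq_zero : (2 : F64) = 0 := CharP.cast_eq_zero F64 2

/-! ### Binary coordinates and finite checks -/

/-- The combination of the values of `f` at the binary digits of `n`. -/
noncomputable def bitSum {M : Type*} [AddCommMonoid M] (d : ℕ) (f : ℕ → M) (n : ℕ) : M :=
  ∑ i ∈ Finset.range d, if n.testBit i then f i else 0

theorem bitSum_zero {M : Type*} [AddCommMonoid M] (d : ℕ) (f : ℕ → M) : bitSum d f 0 = 0 := by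
  simp [bitSum]

theorem bitSum_xor (d : ℕ) (f : ℕ → F64) (m n : ℕ) :
    bitSum d f (m ^^^ n) = bitSum d f m + bitSum d f n := by
  unfold bitSum
  rw [← Finset.sum_add_distrib]
  refine Finset.sum_congr rfl fun i _ => ?_
  rw [Nat.testBit_xor]
  have := CharTwo.add_self_eq_zero (f i)
  cases m.testBit i <;> cases n.testBit i <;> simp [this]

/-- The bitwise `xor` of the values of `f` at the binary digits of `n`. -/
def bitXor (d : ℕ) (f : ℕ → ℕ) (n : ℕ) : ℕ :=
  (List.range d).foldr (fun i acc => (if n.testBit i then f i else 0) ^^^ acc) 0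

theorem map_bitXor {φ : ℕ → F64} (h0 : φ 0 = 0) (hφ : ∀ m n, φ (m ^^^ n) = φ m + φ n)
    (d : ℕ) (f : ℕ → ℕ) (n : ℕ) : φ (bitXor d f n) = bitSum d (fun i => φ (f i)) n := by
  unfold bitXor bitSum
  rw [← List.toFinset_range, List.sum_toFinset _ List.nodup_range]
  induction List.range d with
  | nil => simpa using h0
  | cons i l ih =>
    rw [List.foldr_cons, hφ, ih, List.map_cons, List.sum_cons]
    congr 1
    split_ifs <;> simp [h0]

/-- Coordinates of `θ ^ k + θ ^ (8 * k)` with respect to `1, s, s ^ 2`, where `s = θ + θ ^ 8`. -/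
def traceCode (k : ℕ) : ℕ := [0, 2, 4, 1, 6, 6, 1, 4, 2].getD (k % 9) 0

/-- The squaring map in coordinates. -/
def sqCode (n : ℕ) : ℕ := bitXor 6 (fun i => bitXor 6 (fun j => traceCode (1 + i + 2 * j)) n) n

/-- The commutator map in coordinates. -/
def commCode (m n : ℕ) : ℕ := sqCode (m ^^^ n) ^^^ sqCode m ^^^ sqCode n

theorem sqCode_lt : ∀ n < 64, sqCode n < 8 := by decide +kernel

theorem sqCode_eq_zero : ∀ n < 64, sqCode n = 0 → n = 0 := by decide +kernel

/-- Commutators with 1, `θ`, `θ ^ 2` already separate points, so an additive map fixing these three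
needs no check on the rest of the basis. -/
theorem commCode_nondegenerate : ∀ n < 64,
    commCode 1 n = 0 → commCode 2 n = 0 → commCode 4 n = 0 → n = 0 := by decide +kernel

-- Here `x`, `y`, `z` stand for the images of `θ`, `θ ^ 2`, `θ ^ 3` under a map fixing 1. The
-- equations are additive relations among squares and commutators of 1, `θ`, `θ ^ 2`, `θ ^ 3`, so
-- they survive any linear change of `F8`. Each premise precedes the next quantifier to prune the
-- search.
set_option synthInstance.maxHeartbeats 0 in
set_option synthInstance.maxSize 10000 in
theorem code_rigid : ∀ z < 64, sqCode z = 2 ∧ commCode 1 z = 2 →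
    ∀ x < 64, commCode x z = commCode 1 x ^^^ sqCode x →
    ∀ y < 64, (sqCode y = 2 ^^^ sqCode x ∧ commCode 1 y = 2 ^^^ commCode 1 x ∧
      commCode x y = 2 ^^^ commCode 1 x ∧ commCode y z = 2) → x = 2 ∧ y = 4 := by
  decide +kernel

theorem commCode_lt {m n : ℕ} (hm : m < 64) (hn : n < 64) : commCode m n < 8 :=
  Nat.xor_lt_two_pow (n := 3) (Nat.xor_lt_two_pow (n := 3)
    (sqCode_lt _ (Nat.xor_lt_two_pow (n := 6) hm hn)) (sqCode_lt _ hm)) (sqCode_lt _ hn)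

/-- The element of the field with `64` elements with coordinates `n`. -/
noncomputable def ofCode (θ : F64) (n : ℕ) : F64 := bitSum 6 (θ ^ ·) n

/-- The element of the subfield with `8` elements with coordinates `n`. -/
noncomputable def ofTraceCode (θ : F64) (n : ℕ) : F64 := bitSum 3 ((θ + θ ^ 8) ^ ·) n

theorem pow_nine_eq_one {θ : F64} (hθ : θ ^ 6 + θ ^ 3 + 1 = 0) : θ ^ 9 = 1 := by
  linear_combination (θ ^ 3 - 1) * hθ

/-- As `θ ^ 9 = 1`, the sum is `θ ^ k + θ ^ (-k)`, a polynomial in `s = θ + θ ^ (-1)`; only `k`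
modulo 9 matters. -/
theorem trace_pow {θ : F64} (hθ : θ ^ 6 + θ ^ 3 + 1 = 0) (k : ℕ) :
    θ ^ k + θ ^ (8 * k) = ofTraceCode θ (traceCode k) := by
  have h9 := pow_nine_eq_one hθ
  have h2 := F64.two_eq_zero
  have h1 : ∀ m, θ ^ m = θ ^ (m % 9) := fun m => pow_eq_pow_mod m h9
  have hs : (θ + θ ^ 8) ^ 2 = θ ^ 2 + θ ^ 7 := by
    linear_combination (2 + θ ^ 7) * h9 + h2
  rw [h1 k, h1 (8 * k), Nat.mul_mod, traceCode]
  have : k % 9 < 9 := Nat.mod_lt _ (by norm_num)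
  generalize k % 9 = r at this
  interval_cases r <;>
    simp [ofTraceCode, bitSum, Finset.sum_range_succ, Nat.testBit, hs] <;>
    grind

theorem ofTraceCode_xor (θ : F64) (m n : ℕ) :
    ofTraceCode θ (m ^^^ n) = ofTraceCode θ m + ofTraceCode θ n := bitSum_xor _ _ _ _

theorem ofCode_xor (θ : F64) (m n : ℕ) :
    ofCode θ (m ^^^ n) = ofCode θ m + ofCode θ n := bitSum_xor _ _ _ _

theorem cocycle_add_left (ε a a' b : F64) :
    cocycle ε (a + a') b = cocycle ε a b + cocycle ε a' b := by
  apply Subtype.ext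
  simp only [cocycle, Subfield.coe_add, F64.add_pow_eight]
  ring

theorem cocycle_add_right (ε a b b' : F64) :
    cocycle ε a (b + b') = cocycle ε a b + cocycle ε a b' := by
  apply Subtype.ext
  simp only [cocycle, Subfield.coe_add, F64.add_pow_two, F64.add_pow_sixteen]
  ring

/-- The cocycle as a biadditive map. -/
noncomputable def cocycleHom (ε : F64) : F64 →+ F64 →+ F8 :=
  AddMonoidHom.mk' (fun a => AddMonoidHom.mk' (cocycle ε a) (cocycle_add_right ε a))
    fun a a' => AddMonoidHom.ext fun b => cocycle_add_left ε a a' b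

theorem map_bitSum {M N : Type*} [AddCommMonoid M] [AddCommMonoid N] (g : M →+ N) (d : ℕ)
    (f : ℕ → M) (n : ℕ) : g (bitSum d f n) = bitSum d (fun i => g (f i)) n := by
  unfold bitSum
  rw [map_sum]
  refine Finset.sum_congr rfl fun i _ => ?_
  split_ifs <;> simp

/-- Biadditivity reduces to powers of `θ`, where the cocycle of `θ ^ i` and `θ ^ j` is the trace of
`θ ^ (1 + i + 2 * j)`. -/
theorem cocycle_self_ofCode {θ : F64} (hθ : θ ^ 6 + θ ^ 3 + 1 = 0) (n : ℕ) :
    (cocycle θ (ofCode θ n) (ofCode θ n) : F64) = ofTraceCode θ (sqCode n) := by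
  have hx := ofTraceCode_xor θ
  have h0 : ofTraceCode θ 0 = 0 := bitSum_zero _ _
  rw [sqCode, map_bitXor h0 hx]
  simp only [map_bitXor h0 hx]
  let g : F64 →+ F64 :=
    F8.subtype.toAddMonoidHom.comp ((cocycleHom θ).flip (ofCode θ n))
  have hg : ∀ a, g a = (cocycle θ a (ofCode θ n) : F64) := fun a => rfl
  rw [← hg]
  conv_lhs => rw [ofCode, map_bitSum]
  congr 1
  funext i
  rw [hg]
  let g' : F64 →+ F64 := F8.subtype.toAddMonoidHom.comp (cocycleHom θ (θ ^ i))
  have hg' : ∀ a, g' a = (cocycle θ (θ ^ i) a : F64) := fun a => rfl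
  rw [← hg', ofCode, map_bitSum]
  congr 1
  funext j
  rw [hg', ← trace_pow hθ]
  change θ ^ i * (θ ^ j) ^ 2 * θ + (θ ^ i) ^ 8 * (θ ^ j) ^ 16 * θ ^ 8 = _
  ring

/-- The element `s = θ + θ ^ 8` is a root of the irreducible cubic `X ^ 3 + X + 1`. -/
theorem ofTraceCode_eq_zero {θ : F64} (hθ : θ ^ 6 + θ ^ 3 + 1 = 0) :
    ∀ n < 8, ofTraceCode θ n = 0 → n = 0 := by
  have h9 := pow_nine_eq_one hθ
  have h2 := F64.two_eq_zero
  have hs : (θ + θ ^ 8) ^ 3 + (θ + θ ^ 8) + 1 = 0 := by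
    have : (θ + θ ^ 8) ^ 3 = θ ^ 3 + θ + θ ^ 8 + θ ^ 6 := by
      grind
    grind
  unfold ofTraceCode
  generalize θ + θ ^ 8 = s at hs
  intro n hn
  interval_cases n <;> simp [bitSum, Finset.sum_range_succ, Nat.testBit] <;> grind

theorem eq_of_ofTraceCode_eq {θ : F64} (hθ : θ ^ 6 + θ ^ 3 + 1 = 0) {m n : ℕ} (hm : m < 8)
    (hn : n < 8) (h : ofTraceCode θ m = ofTraceCode θ n) : m = n := by
  have h1 : ofTraceCode θ (m ^^^ n) = 0 := by
    rw [ofTraceCode_xor, h, CharTwo.add_self_eq_zero]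
  exact Nat.xor_eq_zero_iff.1
    (ofTraceCode_eq_zero hθ _ (Nat.xor_lt_two_pow (n := 3) hm hn) h1)

/-- Injectivity comes from the squaring map: a code of 0 has square 0, and only the zero code does.
Counting then gives surjectivity. -/
theorem exists_ofCode {θ : F64} (hθ : θ ^ 6 + θ ^ 3 + 1 = 0) (a : F64) :
    ∃ n < 64, ofCode θ n = a := by
  have hinj : Function.Injective fun n : Fin 64 => ofCode θ n := by
    intro m n h
    have h1 : ofCode θ (m ^^^ n) = 0 := by
      rw [ofCode_xor]
      exact (congrArg (· + _) h).trans (CharTwo.add_self_eq_zero _)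
    have hlt : (m : ℕ) ^^^ n < 64 := Nat.xor_lt_two_pow (n := 6) m.2 n.2
    have h2 := cocycle_self_ofCode hθ (m ^^^ n)
    rw [h1] at h2
    have h3 : ofTraceCode θ (sqCode (m ^^^ n)) = 0 := by
      rw [← h2]
      simp [cocycle]
    exact Fin.ext (Nat.xor_eq_zero_iff.1 (sqCode_eq_zero _ hlt
      (ofTraceCode_eq_zero hθ _ (sqCode_lt _ hlt) h3)))
  have hb := (Nat.bijective_iff_injective_and_card _).2 ⟨hinj, by rw [F64.natCard]; simp⟩
  obtain ⟨n, hn⟩ := hb.2 a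
  exact ⟨n, n.2, hn⟩

/-! ### Squaring, commutators and rigidity -/

/-- The squaring map `F64 → F8` of the group `P(ε)`. -/
noncomputable def sqMap (ε a : F64) : F8 := cocycle ε a a

/-- The commutator map of the group `P(ε)`. -/
noncomputable def commMap (ε a b : F64) : F8 := cocycle ε a b + cocycle ε b a

theorem sqMap_add (ε a b : F64) : sqMap ε (a + b) = sqMap ε a + sqMap ε b + commMap ε a b := by
  simp only [sqMap, commMap, cocycle_add_left, cocycle_add_right]
  abel

theorem F8.add_self (x : F8) : x + x = 0 := Subtype.ext (CharTwo.add_self_eq_zero (x : F64))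

theorem commMap_eq (ε a b : F64) :
    commMap ε a b = sqMap ε (a + b) + sqMap ε a + sqMap ε b := by
  rw [sqMap_add]
  linear_combination - F8.add_self (sqMap ε a) - F8.add_self (sqMap ε b)

theorem sqMap_ofCode {θ : F64} (hθ : θ ^ 6 + θ ^ 3 + 1 = 0) (n : ℕ) :
    (sqMap θ (ofCode θ n) : F64) = ofTraceCode θ (sqCode n) := cocycle_self_ofCode hθ n

theorem commMap_ofCode {θ : F64} (hθ : θ ^ 6 + θ ^ 3 + 1 = 0) (m n : ℕ) :
    (commMap θ (ofCode θ m) (ofCode θ n) : F64) = ofTraceCode θ (commCode m n) := by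
  rw [commMap_eq, ← ofCode_xor, Subfield.coe_add, Subfield.coe_add, sqMap_ofCode hθ,
    sqMap_ofCode hθ, sqMap_ofCode hθ, ← ofTraceCode_xor, ← ofTraceCode_xor, commCode]

/-- An additive map that is compatible with the squaring map and fixes `1` is the identity. -/
theorem eq_self_of_sqMap {θ : F64} (hθ : θ ^ 6 + θ ^ 3 + 1 = 0) (A : F64 →+ F64) (L : F8 →+ F8)
    (h : ∀ a, sqMap θ (A a) = L (sqMap θ a)) (h1 : A 1 = 1) (a : F64) : A a = a := by
  have hB : ∀ a b, commMap θ (A a) (A b) = L (commMap θ a b) := by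
    intro a b
    rw [commMap_eq, commMap_eq, ← map_add, h, h, h, map_add, map_add]
  have hx := ofTraceCode_xor θ
  obtain ⟨x, hx64, hxA⟩ := exists_ofCode hθ (A (ofCode θ 2))
  obtain ⟨y, hy64, hyA⟩ := exists_ofCode hθ (A (ofCode θ 4))
  obtain ⟨z, hz64, hzA⟩ := exists_ofCode hθ (A (ofCode θ 8))
  have c1 : ofCode θ 1 = 1 := by
    simp [ofCode, bitSum, Finset.sum_range_succ, Nat.testBit]
  have h1A : ofCode θ 1 = A (ofCode θ 1) := by rw [c1, h1]
  have hsq : ∀ {m m'}, ofCode θ m' = A (ofCode θ m) →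
      (L (sqMap θ (ofCode θ m)) : F64) = ofTraceCode θ (sqCode m') := by
    intro m m' hm
    rw [← sqMap_ofCode hθ, hm, h]
  have hcomm : ∀ {m m' n n'}, ofCode θ m' = A (ofCode θ m) → ofCode θ n' = A (ofCode θ n) →
      (L (commMap θ (ofCode θ m) (ofCode θ n)) : F64) = ofTraceCode θ (commCode m' n') := by
    intro m m' n n' hm hn
    rw [← commMap_ofCode hθ, hm, hn, hB]
  have h0 : (L 0 : F64) = ofTraceCode θ 0 := by
    rw [map_zero, ofTraceCode, bitSum_zero]
    rfl
  -- `L` is unknown but additive, so a relation `u = v + w` in `F8` yields the same relation between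
  -- the codes of the images.
  have transfer : ∀ {u v w : F8} {i j k i' j' k' : ℕ}, (L u : F64) = ofTraceCode θ i' →
      (L v : F64) = ofTraceCode θ j' → (L w : F64) = ofTraceCode θ k' → i' < 8 → j' < 8 → k' < 8 →
      (u : F64) = ofTraceCode θ i → (v : F64) = ofTraceCode θ j → (w : F64) = ofTraceCode θ k →
      i = j ^^^ k → i' = j' ^^^ k' := by
    intro u v w i j k i' j' k' hu hv hw hi hj hk hu' hv' hw' hijk
    have huvw : u = v + w := Subtype.ext (by
      rw [Subfield.coe_add, hu', hv', hw', hijk, hx])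
    refine eq_of_ofTraceCode_eq hθ hi (Nat.xor_lt_two_pow (n := 3) hj hk) ?_
    rw [hx, ← hu, ← hv, ← hw, huvw, map_add, Subfield.coe_add]
  have z0 : ((0 : F8) : F64) = ofTraceCode θ 0 := by
    rw [ofTraceCode, bitSum_zero]
    rfl
  have S := sqMap_ofCode hθ
  have C := commMap_ofCode hθ
  have one_lt : 1 < 64 := by norm_num
  have r1 := transfer (hsq hzA) (hsq h1A) h0 (sqCode_lt _ hz64) (sqCode_lt _ one_lt) (by norm_num)
    (S _) (S _) z0 (by decide)
  have r2 := transfer (hcomm h1A hzA) (hsq h1A) h0 (commCode_lt one_lt hz64) (sqCode_lt _ one_lt)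
    (by norm_num) (C _ _) (S _) z0 (by decide)
  have r3 := transfer (hcomm hxA hzA) (hcomm h1A hxA) (hsq hxA) (commCode_lt hx64 hz64)
    (commCode_lt one_lt hx64) (sqCode_lt _ hx64) (C _ _) (C _ _) (S _) (by decide)
  have r4 := transfer (hsq hyA) (hsq h1A) (hsq hxA) (sqCode_lt _ hy64) (sqCode_lt _ one_lt)
    (sqCode_lt _ hx64) (S _) (S _) (S _) (by decide)
  have r5 := transfer (hcomm h1A hyA) (hsq h1A) (hcomm h1A hxA) (commCode_lt one_lt hy64)
    (sqCode_lt _ one_lt) (commCode_lt one_lt hx64) (C _ _) (S _) (C _ _) (by decide)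
  have r6 := transfer (hcomm hxA hyA) (hsq h1A) (hcomm h1A hxA) (commCode_lt hx64 hy64)
    (sqCode_lt _ one_lt) (commCode_lt one_lt hx64) (C _ _) (S _) (C _ _) (by decide)
  have r7 := transfer (hcomm hyA hzA) (hsq h1A) h0 (commCode_lt hy64 hz64) (sqCode_lt _ one_lt)
    (by norm_num) (C _ _) (S _) z0 (by decide)
  have s1 : sqCode 1 = 2 := by decide
  rw [s1, Nat.xor_zero] at r1 r2 r7
  rw [s1] at r4 r5 r6
  obtain ⟨rfl, rfl⟩ := code_rigid z hz64 ⟨r1, r2⟩ x hx64 r3 y hy64 ⟨r4, r5, r6, r7⟩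
  -- `A` fixes `1`, `θ`, `θ ^ 2`, so `L` is the identity
  have hL : ∀ k < 8, ∀ w : F8, (w : F64) = ofTraceCode θ k → L w = w := by
    have hadd : ∀ v w : F8, L v = v → L w = w → L (v + w) = v + w := by
      intro v w hv hw
      rw [map_add, hv, hw]
    have l2 : L (sqMap θ (ofCode θ 1)) = sqMap θ (ofCode θ 1) :=
      Subtype.ext ((hsq h1A).trans (S 1).symm)
    have l6 : L (sqMap θ (ofCode θ 2)) = sqMap θ (ofCode θ 2) :=
      Subtype.ext ((hsq hxA).trans (S 2).symm)
    have l5 : L (commMap θ (ofCode θ 1) (ofCode θ 2)) = commMap θ (ofCode θ 1) (ofCode θ 2) :=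
      Subtype.ext ((hcomm h1A hxA).trans (C 1 2).symm)
    have e : ∀ {v w : F8}, (w : F64) = v → L v = v → L w = w := by
      intro v w hvw hv
      rwa [Subtype.ext hvw]
    intro k hk w hw
    -- The codes 2, 6, 5 of the fixed values span all of `F8`; each case writes `k` as an xor of
    -- them.
    have t6 : sqCode 2 = 6 := by decide
    have t5 : commCode 1 2 = 5 := by decide
    have S1 := s1 ▸ S 1
    have S2 := t6 ▸ S 2
    have C12 := t5 ▸ C 1 2
    interval_cases k
    · exact e (hw.trans z0.symm) (map_zero L)
    · refine e ?_ (hadd _ _ (hadd _ _ l2 l6) l5)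
      rw [hw, Subfield.coe_add, Subfield.coe_add, S1, S2, C12, ← hx, ← hx]
      rfl
    · exact e (hw.trans S1.symm) l2
    · refine e ?_ (hadd _ _ l6 l5)
      rw [hw, Subfield.coe_add, S2, C12, ← hx]
      rfl
    · refine e ?_ (hadd _ _ l2 l6)
      rw [hw, Subfield.coe_add, S1, S2, ← hx]
      rfl
    · exact e (hw.trans C12.symm) l5
    · exact e (hw.trans S2.symm) l6
    · refine e ?_ (hadd _ _ l2 l5)
      rw [hw, Subfield.coe_add, S1, C12, ← hx]
      rfl
  obtain ⟨m, hm, rfl⟩ := exists_ofCode hθ a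
  obtain ⟨n, hn, hnA⟩ := exists_ofCode hθ (A (ofCode θ m))
  have hcode : ∀ k < 64, ofCode θ k = A (ofCode θ k) → commCode k (n ^^^ m) = 0 := by
    intro k hk hkA
    have h3 : commMap θ (ofCode θ k) (ofCode θ n) = commMap θ (ofCode θ k) (ofCode θ m) := by
      rw [hnA, hkA, hB, ← hkA]
      exact hL _ (commCode_lt hk hm) _ (C k m)
    have h4 : commMap θ (ofCode θ k) (ofCode θ (n ^^^ m)) = 0 := by
      rw [ofCode_xor, commMap, cocycle_add_left, cocycle_add_right]
      rw [commMap, commMap] at h3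
      linear_combination h3 + F8.add_self (cocycle θ (ofCode θ k) (ofCode θ m)) +
        F8.add_self (cocycle θ (ofCode θ m) (ofCode θ k))
    refine ofTraceCode_eq_zero hθ _ (commCode_lt hk (Nat.xor_lt_two_pow (n := 6) hn hm)) ?_
    rw [← C, h4]
    rfl
  have := commCode_nondegenerate _ (Nat.xor_lt_two_pow (n := 6) hn hm) (hcode 1 one_lt h1A)
    (hcode 2 hx64 hxA) (hcode 4 hy64 hyA)
  rw [← hnA, Nat.xor_eq_zero_iff.1 this]

theorem F64.add_pow_four (x y : F64) : (x + y) ^ 4 = x ^ 4 + y ^ 4 :=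
  add_pow_char_pow x y 2 2

/-! ### Powers of a generator -/

section Generator

variable {ε : F64ˣ}

theorem orderOf_generator (hε : ∀ u : F64ˣ, u ∈ Subgroup.zpowers ε) : orderOf ε = 63 := by
  rw [orderOf_eq_card_of_forall_mem_zpowers hε, Nat.card_units, F64.natCard]

theorem generator_pow_eq_iff (hε : ∀ u : F64ˣ, u ∈ Subgroup.zpowers ε) {m n : ℕ} :
    (ε : F64) ^ m = (ε : F64) ^ n ↔ m ≡ n [MOD 63] := by
  rw [← Units.val_pow_eq_pow_val, ← Units.val_pow_eq_pow_val, Units.val_inj, pow_eq_pow_iff_modEq,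
    orderOf_generator hε]

theorem generator_pow_63 (hε : ∀ u : F64ˣ, u ∈ Subgroup.zpowers ε) : (ε : F64) ^ 63 = 1 := by
  rw [← pow_zero (ε : F64), generator_pow_eq_iff hε]
  rfl

theorem exists_generator_pow (hε : ∀ u : F64ˣ, u ∈ Subgroup.zpowers ε) {a : F64} (ha : a ≠ 0) :
    ∃ n < 63, (ε : F64) ^ n = a := by
  have h := hε (Units.mk0 a ha)
  rw [← mem_powers_iff_mem_zpowers] at h
  obtain ⟨n, hn⟩ := h
  refine ⟨n % 63, Nat.mod_lt _ (by norm_num), ?_⟩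
  rw [(generator_pow_eq_iff hε).2 (Nat.mod_modEq n 63), ← Units.val_pow_eq_pow_val]
  exact congrArg Units.val hn

theorem generator_pow_mem_F8 (hε : ∀ u : F64ˣ, u ∈ Subgroup.zpowers ε) (n : ℕ) :
    (ε : F64) ^ n ∈ F8 ↔ 9 ∣ n := by
  rw [mem_F8_iff, ← pow_mul, generator_pow_eq_iff hε, Nat.ModEq]
  omega

/-- For `a = ε ^ n` vanishing would force `21 * n + 7 ≡ 0` modulo 63, that is, `3 * n + 1 ≡ 0`
modulo 9. -/
theorem sqMap_eq_zero (hε : ∀ u : F64ˣ, u ∈ Subgroup.zpowers ε) {a : F64}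
    (h : sqMap (ε : F64) a = 0) : a = 0 := by
  by_contra ha
  obtain ⟨n, -, rfl⟩ := exists_generator_pow hε ha
  have h1 : (ε : F64) ^ (3 * n + 1) + (ε : F64) ^ (24 * n + 8) = 0 := by
    rw [← ZeroMemClass.coe_zero F8, ← h, sqMap, cocycle]
    ring
  rw [CharTwo.add_eq_zero, generator_pow_eq_iff hε, Nat.ModEq] at h1
  omega

theorem sqMap_zero (ε : F64) : sqMap ε 0 = 0 := by
  apply Subtype.ext
  simp [sqMap, cocycle]

/-- `ε ^ 28` has order 9, and `X ^ 9 - 1 = (X ^ 3 - 1) * (X ^ 6 + X ^ 3 + 1)`. -/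
theorem generator_pow_28 (hε : ∀ u : F64ˣ, u ∈ Subgroup.zpowers ε) :
    ((ε : F64) ^ 28) ^ 6 + ((ε : F64) ^ 28) ^ 3 + 1 = 0 := by
  have h1 : (ε : F64) ^ 84 - 1 ≠ 0 := by
    rw [sub_ne_zero, ← pow_zero (ε : F64), Ne, generator_pow_eq_iff hε]
    decide
  refine (mul_eq_zero.1 ?_).resolve_left h1
  have h2 := (generator_pow_eq_iff hε (m := 252) (n := 0)).2 rfl
  linear_combination h2

theorem F8.natCard (hε : ∀ u : F64ˣ, u ∈ Subgroup.zpowers ε) : Nat.card F8 = 8 := by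
  let f : Option (Fin 7) → F8 := fun o => o.elim 0 fun k =>
    ⟨(ε : F64) ^ (9 * (k : ℕ)), (generator_pow_mem_F8 hε _).2 (dvd_mul_right _ _)⟩
  have hne : ∀ n : ℕ, (ε : F64) ^ n ≠ 0 := fun n => pow_ne_zero _ ε.ne_zero
  have hf : Function.Bijective f := by
    constructor
    · rintro (_ | k) (_ | l) h
      · rfl
      · exact absurd (congrArg Subtype.val h).symm (hne _)
      · exact absurd (congrArg Subtype.val h) (hne _)
      · have h1 := (generator_pow_eq_iff hε).1 (congrArg Subtype.val h)
        rw [Nat.ModEq] at h1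
        congr 1
        ext
        omega
    · intro x
      by_cases hx : (x : F64) = 0
      · exact ⟨none, Subtype.ext hx.symm⟩
      · obtain ⟨n, hn, hnx⟩ := exists_generator_pow hε hx
        have h9 : 9 ∣ n := by
          rw [← generator_pow_mem_F8 hε, hnx]
          exact x.2
        obtain ⟨k, rfl⟩ := h9
        exact ⟨some ⟨k, by omega⟩, Subtype.ext hnx⟩
  rw [← Nat.card_congr (Equiv.ofBijective f hf)]
  simp

end Generator

/-! ### Explicit automorphisms -/

namespace PGroup

variable {ε : F64}

@[simp]
theorem mul_fst (p q : PGroup ε) : (p * q).fst = p.fst + q.fst := rfl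

@[simp]
theorem mul_snd (p q : PGroup ε) : (p * q).snd = p.snd + q.snd + cocycle ε p.fst q.fst := rfl

@[simp]
theorem one_fst : (1 : PGroup ε).fst = 0 := rfl

@[simp]
theorem one_snd : (1 : PGroup ε).snd = 0 := rfl

/-- The underlying set of `P(ε)` as a product. -/
def equivProd (ε : F64) : PGroup ε ≃ F64 × F8 where
  toFun p := (p.fst, p.snd)
  invFun p := ⟨p.1, p.2⟩
  left_inv _ := rfl
  right_inv _ := rfl

instance : Finite (PGroup ε) := Finite.of_equiv _ (equivProd ε).symm

theorem sq_eq (p : PGroup ε) : p ^ 2 = ⟨0, sqMap ε p.fst⟩ := by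
  rw [pow_two]
  apply PGroup.ext
  · exact CharTwo.add_self_eq_zero _
  · rw [mul_snd, F8.add_self, zero_add, sqMap]

theorem cocycle_zero_left (ε b : F64) : cocycle ε 0 b = 0 := by
  apply Subtype.ext
  simp [cocycle]

theorem cocycle_zero_right (ε a : F64) : cocycle ε a 0 = 0 := by
  apply Subtype.ext
  simp [cocycle]

theorem eq_mk_mul (p : PGroup ε) : p = ⟨p.fst, 0⟩ * ⟨0, p.snd⟩ := by
  apply PGroup.ext
  · simp
  · simp [cocycle_zero_right]

/-- The automorphism `(a, x) ↦ (A a, L x + f a)`. -/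
noncomputable def autOf (A : F64 →+ F64) (L : F8 →+ F8) (f : F64 →+ F8)
    (hA : ∀ a, A a = 0 → a = 0) (hL : ∀ x, L x = 0 → x = 0)
    (h : ∀ a b, cocycle ε (A a) (A b) = L (cocycle ε a b)) : MulAut (PGroup ε) :=
  MulEquiv.ofBijective
    (MonoidHom.mk' (fun p : PGroup ε => (⟨A p.fst, L p.snd + f p.fst⟩ : PGroup ε)) fun p q => by
      apply PGroup.ext
      · simp
      · simp only [mul_fst, mul_snd, map_add, h]
        abel)
    (Finite.injective_iff_bijective.1 <| (injective_iff_map_eq_one _).2 fun p hp => by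
      have h1 : A p.fst = 0 := congrArg PGroup.fst hp
      have h2 : L p.snd + f p.fst = 0 := congrArg PGroup.snd hp
      have h3 := hA _ h1
      rw [h3, map_zero, add_zero] at h2
      exact PGroup.ext h3 (hL _ h2))

/-- The automorphism `(a, x) ↦ (a, x + f a)`. -/
noncomputable def central (f : F64 →+ F8) : MulAut (PGroup ε) :=
  autOf (.id _) (.id _) f (fun _ => id) (fun _ => id) fun _ _ => rfl

theorem central_apply (f : F64 →+ F8) (p : PGroup ε) :
    central f p = ⟨p.fst, p.snd + f p.fst⟩ := rfl

/-- The automorphism `(a, x) ↦ (μ a, μ ^ 3 x)` for nonzero `μ` in the field with `8` elements. -/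
noncomputable def scale (μ : F8ˣ) : MulAut (PGroup ε) :=
  autOf (AddMonoidHom.mulLeft (μ : F8)) (AddMonoidHom.mulLeft ((μ : F8) ^ 3)) 0
    (fun a h => (mul_eq_zero.1 h).resolve_left fun h' => μ.ne_zero (Subtype.ext h'))
    (fun x h => (mul_eq_zero.1 h).resolve_left (pow_ne_zero _ μ.ne_zero))
    (fun a b => by
      have h8 := (mem_F8_iff _).1 (μ : F8).2
      apply Subtype.ext
      change ((μ : F8) : F64) * a * (((μ : F8) : F64) * b) ^ 2 * ε +
        (((μ : F8) : F64) * a) ^ 8 * (((μ : F8) : F64) * b) ^ 16 * ε ^ 8 =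
        ((μ : F8) : F64) ^ 3 * (a * b ^ 2 * ε + a ^ 8 * b ^ 16 * ε ^ 8)
      generalize ((μ : F8) : F64) = m at h8
      have h24 : m ^ 24 = m ^ 3 := by
        rw [pow_mul m 8 3, h8]
      linear_combination a ^ 8 * b ^ 16 * ε ^ 8 * h24)

theorem scale_apply (μ : F8ˣ) (p : PGroup ε) :
    scale μ p = ⟨(μ : F8) * p.fst, (μ : F8) ^ 3 * p.snd⟩ := by
  apply PGroup.ext
  · rfl
  · exact add_zero _

/-- The automorphism `(a, x) ↦ (ε a ^ 4, x ^ 4)`. -/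
noncomputable def frob (hε : ε ≠ 0) : MulAut (PGroup ε) :=
  autOf (AddMonoidHom.mk' (fun a => ε * a ^ 4) fun a b => by
      rw [F64.add_pow_four]
      ring)
    (AddMonoidHom.mk' (fun x => x ^ 4) fun x y => Subtype.ext (F64.add_pow_four (x : F64) y)) 0
    (fun a h => eq_zero_of_pow_eq_zero ((mul_eq_zero.1 h).resolve_left hε))
    (fun x h => eq_zero_of_pow_eq_zero h)
    (fun a b => by
      apply Subtype.ext
      change ε * a ^ 4 * (ε * b ^ 4) ^ 2 * ε + (ε * a ^ 4) ^ 8 * (ε * b ^ 4) ^ 16 * ε ^ 8 =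
        (a * b ^ 2 * ε + a ^ 8 * b ^ 16 * ε ^ 8) ^ 4
      rw [F64.add_pow_four]
      ring)

theorem frob_apply (hε : ε ≠ 0) (p : PGroup ε) :
    frob hε p = ⟨ε * p.fst ^ 4, p.snd ^ 4⟩ := by
  apply PGroup.ext
  · rfl
  · exact add_zero _

end PGroup

/-- Cubing is thus a bijection of `F8`, inverted by the fifth power. -/
theorem F8.pow_fifteen (x : F8) : x ^ 15 = x := by
  have h : x ^ 8 = x := Subtype.ext ((mem_F8_iff _).1 x.2)
  linear_combination (x ^ 7 + 1) * h

/-- For `μ` in `F8` the square of `μ` is `μ ^ 3` times that of 1, and cubes exhaust `F8`. -/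
theorem exists_sqMap_eq {ε : F64} (h0 : ∀ a, sqMap ε a = 0 → a = 0) (x : F8) :
    ∃ a, sqMap ε a = x := by
  by_cases hx : x = 0
  · exact ⟨0, by rw [sqMap_zero, hx]⟩
  have hw : sqMap ε 1 ≠ 0 := fun h => one_ne_zero (h0 _ h)
  set μ : F8 := (x / sqMap ε 1) ^ 5
  refine ⟨μ, ?_⟩
  have h1 : sqMap ε μ = μ ^ 3 * sqMap ε 1 := by
    have h8 : (μ : F64) ^ 8 = μ := (mem_F8_iff _).1 μ.2
    apply Subtype.ext
    change (μ : F64) * (μ : F64) ^ 2 * ε + (μ : F64) ^ 8 * (μ : F64) ^ 16 * ε ^ 8 =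
      (μ : F64) ^ 3 * (1 * 1 ^ 2 * ε + 1 ^ 8 * 1 ^ 16 * ε ^ 8)
    have h16 : (μ : F64) ^ 16 = (μ : F64) ^ 2 := by rw [pow_mul _ 8 2, h8]
    rw [h8, h16]
    ring
  have h3 : μ ^ 3 = x / sqMap ε 1 := by
    rw [← pow_mul, F8.pow_fifteen]
  rw [h1, h3, div_mul_cancel₀ _ hw]

/-! ### The action on first coordinates and its kernel -/

namespace PGroup

variable {ε : F64}

theorem map_fst_eq_zero (h0 : ∀ a, sqMap ε a = 0 → a = 0) (α : MulAut (PGroup ε))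
    {p : PGroup ε} (hp : p.fst = 0) : (α p).fst = 0 := by
  apply h0
  have h1 : p ^ 2 = 1 := by
    rw [sq_eq, hp, sqMap_zero]
    rfl
  have h2 : (α p) ^ 2 = 1 := by rw [← map_pow, h1, map_one]
  rw [sq_eq] at h2
  exact congrArg PGroup.snd h2

theorem map_fst_congr (h0 : ∀ a, sqMap ε a = 0 → a = 0) (α : MulAut (PGroup ε))
    (p : PGroup ε) : (α p).fst = (α ⟨p.fst, 0⟩).fst := by
  conv_lhs => rw [eq_mk_mul p, map_mul, mul_fst, map_fst_eq_zero h0 α (p := ⟨0, p.snd⟩) rfl,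
    add_zero]

/-- The action of the automorphism group on the first coordinate. -/
noncomputable def fstHom (h0 : ∀ a, sqMap ε a = 0 → a = 0) :
    MulAut (PGroup ε) →* AddMonoid.End F64 where
  toFun α := AddMonoidHom.mk' (fun a => (α ⟨a, 0⟩).fst) fun a b => by
    rw [← mul_fst, ← map_mul, map_fst_congr h0 α (⟨a, 0⟩ * ⟨b, 0⟩)]
    rfl
  map_one' := rfl
  map_mul' α β := AddMonoidHom.ext fun a => map_fst_congr h0 α (β ⟨a, 0⟩)

theorem map_fst (h0 : ∀ a, sqMap ε a = 0 → a = 0) (α : MulAut (PGroup ε)) (p : PGroup ε) :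
    (α p).fst = fstHom h0 α p.fst := map_fst_congr h0 α p

/-- The restriction of an automorphism to the subgroup of all `(0, x)`. -/
noncomputable def sndHom (h0 : ∀ a, sqMap ε a = 0 → a = 0) (α : MulAut (PGroup ε)) : F8 →+ F8 :=
  AddMonoidHom.mk' (fun x => (α ⟨0, x⟩).snd) fun x y => by
    have h : (⟨0, x + y⟩ : PGroup ε) = ⟨0, x⟩ * ⟨0, y⟩ := by
      apply PGroup.ext <;> simp [cocycle_zero_left]
    rw [h, map_mul, mul_snd, map_fst_eq_zero h0 α (p := ⟨0, x⟩) rfl, cocycle_zero_left, add_zero]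

theorem sqMap_fstHom (h0 : ∀ a, sqMap ε a = 0 → a = 0) (α : MulAut (PGroup ε)) (a : F64) :
    sqMap ε (fstHom h0 α a) = sndHom h0 α (sqMap ε a) := by
  have h : (α ⟨a, 0⟩) ^ 2 = α (⟨a, 0⟩ ^ 2) := (map_pow α _ 2).symm
  rw [sq_eq, sq_eq] at h
  exact congrArg PGroup.snd h

theorem central_mem_ker (h0 : ∀ a, sqMap ε a = 0 → a = 0) (f : F64 →+ F8) :
    central f ∈ (fstHom h0).ker := rfl

/-- Every `(0, x)` is the square of some `(a, 0)`, and a square depends only on the first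
coordinate. -/
theorem map_eq_self_of_mem_ker (h0 : ∀ a, sqMap ε a = 0 → a = 0) {α : MulAut (PGroup ε)}
    (hα : α ∈ (fstHom h0).ker) (x : F8) : α ⟨0, x⟩ = ⟨0, x⟩ := by
  obtain ⟨a, rfl⟩ := exists_sqMap_eq h0 x
  have h := sqMap_fstHom h0 α a
  rw [MonoidHom.mem_ker.1 hα] at h
  apply PGroup.ext
  · exact map_fst_eq_zero h0 α rfl
  · exact h.symm

/-- The automorphisms acting trivially on the first coordinate are the central ones. -/
noncomputable def kerEquiv (h0 : ∀ a, sqMap ε a = 0 → a = 0) :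
    Multiplicative (F64 →+ F8) ≃* (fstHom h0).ker :=
  MulEquiv.ofBijective
    (MonoidHom.mk' (fun f => ⟨central f.toAdd, central_mem_ker h0 _⟩) fun f g => by
      apply Subtype.ext
      apply MulEquiv.ext
      intro p
      change (⟨p.fst, p.snd + (f.toAdd p.fst + g.toAdd p.fst)⟩ : PGroup ε) =
        ⟨p.fst, p.snd + g.toAdd p.fst + f.toAdd p.fst⟩
      apply PGroup.ext
      · rfl
      · change p.snd + (f.toAdd p.fst + g.toAdd p.fst) = p.snd + g.toAdd p.fst + f.toAdd p.fst
        abel)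
    (by
      constructor
      · intro f g h
        apply Multiplicative.toAdd.injective
        ext a : 1
        have h1 := congrArg PGroup.snd (DFunLike.congr_fun (congrArg Subtype.val h) (⟨a, 0⟩ : PGroup ε))
        exact add_left_cancel h1
      · rintro ⟨α, hα⟩
        have hfst : ∀ p, (α p).fst = p.fst := fun p => by
          rw [map_fst h0, MonoidHom.mem_ker.1 hα]
          rfl
        have hsnd : ∀ p, (α p).snd = p.snd + (α ⟨p.fst, 0⟩).snd := fun p => by
          conv_lhs => rw [eq_mk_mul p, map_mul, mul_snd, map_eq_self_of_mem_ker h0 hα,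
            cocycle_zero_right, add_zero, add_comm]
        refine ⟨Multiplicative.ofAdd (AddMonoidHom.mk' (fun a => (α ⟨a, 0⟩).snd) fun a b => ?_), ?_⟩
        · have h1 := hsnd (⟨a, 0⟩ * ⟨b, 0⟩)
          rw [map_mul, mul_snd, mul_snd, hfst, hfst] at h1
          change _ = 0 + 0 + cocycle ε a b + (α ⟨a + b, 0⟩).snd at h1
          change _ + _ + cocycle ε a b = _ at h1
          linear_combination - h1
        · apply Subtype.ext
          apply MulEquiv.ext
          intro p
          exact PGroup.ext (hfst p).symm (hsnd p).symm)

end PGroup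

theorem finrank_eq_of_natCard {M : Type*} [AddCommGroup M] [Module (ZMod 2) M] [Finite M] {n : ℕ}
    (h : Nat.card M = 2 ^ n) : Module.finrank (ZMod 2) M = n := by
  rw [Module.natCard_eq_pow_finrank (K := ZMod 2), Nat.card_zmod] at h
  exact Nat.pow_right_injective le_rfl h

theorem nonempty_addEquiv_hom (h8 : Nat.card F8 = 8) :
    Nonempty ((F64 →+ F8) ≃+ (Fin 18 → ZMod 2)) := by
  let _ : Module (ZMod 2) F8 := AddCommGroup.zmodModule fun x => by
    rw [two_nsmul, F8.add_self]
  have e : (F64 →ₗ[ZMod 2] F8) ≃ₗ[ZMod 2] (Fin 18 → ZMod 2) := by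
    apply LinearEquiv.ofFinrankEq
    rw [Module.finrank_linearMap, finrank_eq_of_natCard (n := 6) (by rw [F64.natCard]; norm_num),
      finrank_eq_of_natCard (n := 3) (by rw [h8]; norm_num)]
    simp
  exact ⟨(AddMonoidHom.toZModLinearMapEquiv 2).trans e.toAddEquiv⟩

/-- The homomorphism from a cyclic group of order `n` that sends a generator to `g`. -/
def zmodPowHom {G : Type*} [Group G] (n : ℕ) [NeZero n] (g : G) (hg : g ^ n = 1) :
    Multiplicative (ZMod n) →* G :=
  MonoidHom.mk' (fun k => g ^ k.toAdd.val) fun k l => by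
    rw [toAdd_mul, ZMod.val_add, ← pow_add]
    exact (pow_eq_pow_mod _ hg).symm

theorem zmodPowHom_apply {G : Type*} [Group G] (n : ℕ) [NeZero n] (g : G) (hg : g ^ n = 1)
    (k : Multiplicative (ZMod n)) : zmodPowHom n g hg k = g ^ k.toAdd.val := rfl

theorem actNineOnSeven_apply (g : Multiplicative (ZMod 9)) (n : Multiplicative (ZMod 7)) :
    actNineOnSeven g n = n ^ 2 ^ g.toAdd.val := by
  apply Multiplicative.toAdd.injective
  change ((⟨2, 4, by decide, by decide⟩ : (ZMod 7)ˣ) ^ g.toAdd.val) • n.toAdd = _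
  rw [Units.smul_def, Units.val_pow_eq_pow_val, toAdd_pow, nsmul_eq_mul, Nat.cast_pow]
  rfl

/-! ### The regular group `7:9` -/

namespace PGroup

section

variable {ε : F64}

theorem scale_pow_apply (μ : F8ˣ) (k : ℕ) (p : PGroup ε) :
    ((scale μ : MulAut (PGroup ε)) ^ k) p =
      ⟨((μ : F8) : F64) ^ k * p.fst, ((μ : F8) ^ k) ^ 3 * p.snd⟩ := by
  induction k generalizing p with
  | zero => apply PGroup.ext <;> simp
  | succ k ih =>
    rw [pow_succ, MulAut.mul_apply, ih, scale_apply]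
    apply PGroup.ext <;> ring

theorem frob_pow_apply (hε : ε ≠ 0) (m : ℕ) (p : PGroup ε) :
    (frob hε ^ m) p = ⟨ε ^ (∑ i ∈ Finset.range m, 4 ^ i) * p.fst ^ 4 ^ m, p.snd ^ 4 ^ m⟩ := by
  induction m generalizing p with
  | zero => apply PGroup.ext <;> simp
  | succ m ih =>
    rw [pow_succ, MulAut.mul_apply, ih, frob_apply, Finset.sum_range_succ]
    apply PGroup.ext
    · ring
    · change (p.snd ^ 4) ^ 4 ^ m = _
      ring

theorem frob_semiconj (hε : ε ≠ 0) (μ : F8ˣ) (m j : ℕ) :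
    SemiconjBy (frob hε ^ j) (scale μ ^ m) (scale μ ^ (m * 4 ^ j)) := by
  induction j with
  | zero =>
    rw [pow_zero, pow_zero, mul_one]
    exact SemiconjBy.one_left _
  | succ j ih =>
    have h : ∀ m, SemiconjBy (frob hε) (scale μ ^ m) (scale μ ^ (m * 4)) := by
      intro m
      apply MulEquiv.ext
      intro p
      rw [MulAut.mul_apply, MulAut.mul_apply, scale_pow_apply, scale_pow_apply, frob_apply,
        frob_apply]
      apply PGroup.ext <;> ring
    rw [pow_succ', pow_succ, ← mul_assoc]
    exact (h _).mul_left ih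

end

variable {ε : F64ˣ}

theorem frob_pow_nine (hε : ∀ u : F64ˣ, u ∈ Subgroup.zpowers ε) : frob ε.ne_zero ^ 9 = 1 := by
  have h64 : ∀ a : F64, a ^ 4 ^ 9 = a := by
    intro a
    calc a ^ 4 ^ 9 = ((a ^ 64) ^ 64) ^ 64 := by ring
      _ = a := by rw [F64.pow_card, F64.pow_card, F64.pow_card]
  apply MulEquiv.ext
  intro p
  rw [frob_pow_apply]
  apply PGroup.ext
  · change (ε : F64) ^ (∑ i ∈ Finset.range 9, 4 ^ i) * p.fst ^ 4 ^ 9 = p.fst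
    -- The exponent is `(4 ^ 9 - 1) / 3 = 87381 = 63 * 1387`.
    rw [h64, (generator_pow_eq_iff hε (n := 0)).2 (by decide), pow_zero, one_mul]
  · exact Subtype.ext (h64 _)

/-- The element `ε ^ 9`, a generator of the units of the field with `8` elements. -/
noncomputable def scalar (hε : ∀ u : F64ˣ, u ∈ Subgroup.zpowers ε) : F8ˣ :=
  Units.mk0 ⟨(ε : F64) ^ 9, (generator_pow_mem_F8 hε 9).2 dvd_rfl⟩ fun h =>
    pow_ne_zero 9 ε.ne_zero (congrArg Subtype.val h)

theorem coe_scalar (hε : ∀ u : F64ˣ, u ∈ Subgroup.zpowers ε) :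
    (((scalar hε : F8ˣ) : F8) : F64) = (ε : F64) ^ 9 := rfl

theorem scale_pow_seven (hε : ∀ u : F64ˣ, u ∈ Subgroup.zpowers ε) :
    (scale (scalar hε) : MulAut (PGroup (ε : F64))) ^ 7 = 1 := by
  have h1 : (((scalar hε : F8ˣ) : F8) : F64) ^ 7 = 1 := by
    rw [coe_scalar, ← pow_mul, generator_pow_63 hε]
  have h2 : ((scalar hε : F8ˣ) : F8) ^ 7 = 1 := Subtype.ext h1
  apply MulEquiv.ext
  intro p
  rw [scale_pow_apply, h1, h2]
  apply PGroup.ext <;> simp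

theorem frob_pow_eight_pow_nine (hε : ∀ u : F64ˣ, u ∈ Subgroup.zpowers ε) :
    (frob ε.ne_zero ^ 8) ^ 9 = 1 := by
  rw [pow_right_comm, frob_pow_nine hε, one_pow]

/-- The action of `7:9` on `P(ε)`. -/
noncomputable def sevenNineHom (hε : ∀ u : F64ˣ, u ∈ Subgroup.zpowers ε) :
    SevenNine →* MulAut (PGroup (ε : F64)) :=
  SemidirectProduct.lift (zmodPowHom 7 (scale (scalar hε)) (scale_pow_seven hε))
    -- Conjugation by `frob` raises scalars to the fourth power. Its eighth power, the inverse,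
    -- still generates the group of order 9 and squares them, because `4 ^ 8 ≡ 2` modulo 7.
    (zmodPowHom 9 (frob ε.ne_zero ^ 8) (frob_pow_eight_pow_nine hε))
    fun g => MonoidHom.ext fun n => by
      change zmodPowHom 7 (scale (scalar hε)) (scale_pow_seven hε) (actNineOnSeven g n) =
        zmodPowHom 9 (frob ε.ne_zero ^ 8) (frob_pow_eight_pow_nine hε) g *
          zmodPowHom 7 (scale (scalar hε)) (scale_pow_seven hε) n *
          (zmodPowHom 9 (frob ε.ne_zero ^ 8) (frob_pow_eight_pow_nine hε) g)⁻¹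
      rw [eq_mul_inv_iff_mul_eq, actNineOnSeven_apply, map_pow, zmodPowHom_apply, zmodPowHom_apply,
        ← pow_mul, ← pow_mul, (frob_semiconj ε.ne_zero _ _ _).eq]
      congr 1
      rw [pow_eq_pow_mod _ (scale_pow_seven hε), pow_eq_pow_mod (_ * 4 ^ _) (scale_pow_seven hε)]
      congr 1
      refine Nat.ModEq.mul_left _ ?_
      rw [pow_mul]
      exact Nat.ModEq.pow _ (by decide)

theorem sevenNineHom_apply (hε : ∀ u : F64ˣ, u ∈ Subgroup.zpowers ε) (h : SevenNine) :
    sevenNineHom hε h =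
      scale (scalar hε) ^ h.left.toAdd.val * (frob ε.ne_zero ^ 8) ^ h.right.toAdd.val := rfl

theorem sevenNineHom_fst (hε : ∀ u : F64ˣ, u ∈ Subgroup.zpowers ε) (h : SevenNine) :
    (sevenNineHom hε h ⟨1, 0⟩).fst =
      (ε : F64) ^ (9 * h.left.toAdd.val + (4 ^ (8 * h.right.toAdd.val) - 1) / 3) := by
  rw [sevenNineHom_apply, MulAut.mul_apply, scale_pow_apply, ← pow_mul, frob_pow_apply, coe_scalar,
    Nat.geomSum_eq (by norm_num)]
  change ((ε : F64) ^ 9) ^ _ * ((ε : F64) ^ _ * 1 ^ _) = _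
  rw [one_pow, mul_one, ← pow_mul, ← pow_add]

theorem exists_sevenNineHom_eq (hε : ∀ u : F64ˣ, u ∈ Subgroup.zpowers ε) {a : F64} (ha : a ≠ 0) :
    ∃ h, (sevenNineHom hε h ⟨1, 0⟩).fst = a := by
  -- The second summand runs through all residues modulo 9, and `9 * k` then adjusts the residue
  -- modulo 63.
  have key : ∀ n < 63, ∃ k < 7, ∃ j < 9, (9 * k + (4 ^ (8 * j) - 1) / 3) % 63 = n := by
    decide +kernel
  obtain ⟨n, hn, rfl⟩ := exists_generator_pow hε ha
  obtain ⟨k, hk, j, hj, hkj⟩ := key n hn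
  refine ⟨⟨Multiplicative.ofAdd (k : ZMod 7), Multiplicative.ofAdd (j : ZMod 9)⟩, ?_⟩
  rw [sevenNineHom_fst, generator_pow_eq_iff hε]
  change (9 * (k : ZMod 7).val + (4 ^ (8 * (j : ZMod 9).val) - 1) / 3) % 63 = n % 63
  rw [ZMod.val_natCast_of_lt hk, ZMod.val_natCast_of_lt hj, hkj, Nat.mod_eq_of_lt hn]

theorem fstHom_mul_apply {ε : F64} (h0 : ∀ a, sqMap ε a = 0 → a = 0) (α β : MulAut (PGroup ε))
    (a : F64) : fstHom h0 (α * β) a = fstHom h0 α (fstHom h0 β a) := by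
  rw [map_mul]
  rfl

theorem fstHom_ne_zero {ε : F64} (h0 : ∀ a, sqMap ε a = 0 → a = 0) (α : MulAut (PGroup ε)) {a : F64}
    (ha : a ≠ 0) : fstHom h0 α a ≠ 0 := by
  intro h
  have h1 : fstHom h0 (α⁻¹ * α) a = 0 := by
    rw [map_mul]
    exact (congrArg (fstHom h0 α⁻¹) h).trans (map_zero (fstHom h0 α⁻¹))
  rw [inv_mul_cancel, map_one] at h1
  exact ha h1

/-- A surjection from the 63 elements of `7:9` onto the 63 nonzero vectors is injective. -/
theorem eq_one_of_sevenNineHom_eq (hε : ∀ u : F64ˣ, u ∈ Subgroup.zpowers ε) {h : SevenNine}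
    (hh : (sevenNineHom hε h ⟨1, 0⟩).fst = 1) : h = 1 := by
  have h0 := fun a => sqMap_eq_zero hε (a := a)
  let f : SevenNine → F64ˣ := fun h => Units.mk0 _ (fstHom_ne_zero h0 (sevenNineHom hε h) one_ne_zero)
  have hf : Function.Bijective f := by
    have : Finite SevenNine := Finite.of_equiv _ SemidirectProduct.equivProd.symm
    refine (Nat.bijective_iff_surjective_and_card f).2 ⟨fun u => ?_, ?_⟩
    · obtain ⟨h, hh⟩ := exists_sevenNineHom_eq hε u.ne_zero
      exact ⟨h, Units.ext hh⟩
    · rw [SemidirectProduct.card, Nat.card_units, F64.natCard]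
      simp
  refine hf.1 (Units.ext ?_)
  change (sevenNineHom hε h ⟨1, 0⟩).fst = (sevenNineHom hε 1 ⟨1, 0⟩).fst
  rw [hh, map_one]
  rfl

/-! ### The complement and the fusion of elements -/

/-- Multiplication by `ε ^ 12` carries the squaring map of `ε` to that of `ε ^ 28`, since `(ε ^ 12)
^ 3 * ε ^ 28 = ε ^ 64 = ε`. The fixed vector becomes 1, and rigidity applies. -/
theorem fstHom_eq_one (hε : ∀ u : F64ˣ, u ∈ Subgroup.zpowers ε)
    (h0 : ∀ a, sqMap (ε : F64) a = 0 → a = 0) (α : MulAut (PGroup (ε : F64)))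
    (hα : fstHom h0 α ((ε : F64) ^ 12)⁻¹ = ((ε : F64) ^ 12)⁻¹) : fstHom h0 α = 1 := by
  have hc : (ε : F64) ^ 12 ≠ 0 := pow_ne_zero _ ε.ne_zero
  have h63 := generator_pow_63 hε
  have hsq : ∀ b, sqMap ((ε : F64) ^ 28) ((ε : F64) ^ 12 * b) = sqMap (ε : F64) b := by
    intro b
    apply Subtype.ext
    change (ε : F64) ^ 12 * b * ((ε : F64) ^ 12 * b) ^ 2 * (ε : F64) ^ 28 +
      ((ε : F64) ^ 12 * b) ^ 8 * ((ε : F64) ^ 12 * b) ^ 16 * ((ε : F64) ^ 28) ^ 8 =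
      b * b ^ 2 * ε + b ^ 8 * b ^ 16 * (ε : F64) ^ 8
    have h64 : (ε : F64) ^ 64 = ε := F64.pow_card _
    have h512 : (ε : F64) ^ 512 = (ε : F64) ^ 8 := by rw [pow_mul _ 64 8, h64]
    linear_combination b ^ 3 * h64 + b ^ 24 * h512
  let A : F64 →+ F64 := (AddMonoidHom.mulLeft ((ε : F64) ^ 12)).comp
    ((fstHom h0 α).comp (AddMonoidHom.mulLeft ((ε : F64) ^ 12)⁻¹))
  have hA : ∀ a, A a = (ε : F64) ^ 12 * fstHom h0 α (((ε : F64) ^ 12)⁻¹ * a) := fun _ => rfl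
  have hid := eq_self_of_sqMap (generator_pow_28 hε) A (sndHom h0 α)
    (fun a => by
      rw [hA, hsq, sqMap_fstHom, ← hsq, mul_inv_cancel_left₀ hc])
    (by rw [hA, mul_one, hα, mul_inv_cancel₀ hc])
  refine AddMonoidHom.ext fun a => ?_
  have h1 := hid ((ε : F64) ^ 12 * a)
  rw [hA, inv_mul_cancel_left₀ hc] at h1
  exact mul_left_cancel₀ hc h1

/-- Let `v` be the inverse of `ε ^ 12`. If `h₁` and `h₂` send 1 to `v` and to `α⁻¹ v`, then `α * h₂
* h₁⁻¹` fixes `v`, so it lies in the kernel. -/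
theorem isComplement_ker_range (hε : ∀ u : F64ˣ, u ∈ Subgroup.zpowers ε)
    (h0 : ∀ a, sqMap (ε : F64) a = 0 → a = 0) :
    (fstHom h0).ker.IsComplement' (sevenNineHom hε).range := by
  apply Subgroup.isComplement'_of_disjoint_and_mul_eq_univ
  · rw [Subgroup.disjoint_def]
    rintro _ hk ⟨h, rfl⟩
    have h1 : (sevenNineHom hε h ⟨1, 0⟩).fst = 1 := by
      rw [map_fst h0, MonoidHom.mem_ker.1 hk]
      rfl
    rw [eq_one_of_sevenNineHom_eq hε h1, map_one]
  · rw [Set.eq_univ_iff_forall]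
    intro α
    have hc : ((ε : F64) ^ 12)⁻¹ ≠ 0 := inv_ne_zero (pow_ne_zero _ ε.ne_zero)
    obtain ⟨h₁, hh₁⟩ := exists_sevenNineHom_eq hε hc
    obtain ⟨h₂, hh₂⟩ := exists_sevenNineHom_eq hε (fstHom_ne_zero h0 α⁻¹ hc)
    rw [map_fst h0] at hh₁ hh₂
    have e₁ : fstHom h0 (sevenNineHom hε h₁) 1 = ((ε : F64) ^ 12)⁻¹ := hh₁
    have e₂ : fstHom h0 (sevenNineHom hε h₂) 1 = fstHom h0 α⁻¹ ((ε : F64) ^ 12)⁻¹ := hh₂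
    refine ⟨α * sevenNineHom hε (h₂ * h₁⁻¹), ?_, sevenNineHom hε (h₂ * h₁⁻¹)⁻¹, ⟨_, rfl⟩, ?_⟩
    · refine MonoidHom.mem_ker.2 (fstHom_eq_one hε h0 _ ?_)
      have e₃ : fstHom h0 (sevenNineHom hε h₁⁻¹) ((ε : F64) ^ 12)⁻¹ = 1 := by
        rw [← e₁, ← fstHom_mul_apply, ← map_mul, inv_mul_cancel, map_one (sevenNineHom hε)]
        rfl
      rw [map_mul (sevenNineHom hε), fstHom_mul_apply, fstHom_mul_apply, e₃, e₂,
        ← fstHom_mul_apply, mul_inv_cancel, map_one]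
      rfl
    · change α * sevenNineHom hε (h₂ * h₁⁻¹) * sevenNineHom hε (h₂ * h₁⁻¹)⁻¹ = α
      rw [map_inv, mul_inv_cancel_right]

theorem exists_aut_snd_eq (hε : ∀ u : F64ˣ, u ∈ Subgroup.zpowers ε) {a : F64} (ha : a ≠ 0)
    (x y : F8) : ∃ α : MulAut (PGroup (ε : F64)), α ⟨a, x⟩ = ⟨a, y⟩ := by
  have hw : cocycle (ε : F64) 1 1 ≠ 0 := fun h => one_ne_zero (sqMap_eq_zero hε h)
  -- The cocycle with 1 is an additive map to `F8` that is nonzero at 1; rescaling source and target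
  -- gives the prescribed value at `a`.
  let f : F64 →+ F8 := (AddMonoidHom.mulRight ((cocycle (ε : F64) 1 1)⁻¹ * (y - x))).comp
    (((cocycleHom (ε : F64)).flip 1).comp (AddMonoidHom.mulRight a⁻¹))
  have hf : f a = y - x := by
    change cocycle (ε : F64) (a * a⁻¹) 1 * ((cocycle (ε : F64) 1 1)⁻¹ * (y - x)) = y - x
    rw [mul_inv_cancel₀ ha, mul_inv_cancel_left₀ hw]
  refine ⟨central f, ?_⟩
  rw [central_apply]
  apply PGroup.ext
  · rfl
  · change x + f a = y
    rw [hf]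
    ring

/-- Involutions are fused by scalars, as cubing is onto in `F8`. For order 4, `7:9` matches first
coordinates and central automorphisms correct the second. -/
theorem isATGroup (hε : ∀ u : F64ˣ, u ∈ Subgroup.zpowers ε) : IsATGroup (PGroup (ε : F64)) := by
  have h0 := fun a => sqMap_eq_zero hε (a := a)
  have hfst : ∀ p : PGroup (ε : F64), p.fst = 0 ↔ orderOf p ∣ 2 := by
    intro p
    rw [orderOf_dvd_iff_pow_eq_one, sq_eq]
    constructor
    · intro h
      rw [h, sqMap_zero]
      rfl
    · intro h
      exact h0 _ (congrArg PGroup.snd h)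
  intro p q hpq
  by_cases hp : p.fst = 0
  · have hq : q.fst = 0 := by rwa [hfst, ← hpq, ← hfst]
    by_cases hp1 : p = 1
    · rw [hp1, orderOf_one, eq_comm, orderOf_eq_one_iff] at hpq
      exact ⟨1, by rw [hp1, hpq]; rfl⟩
    have hq1 : q ≠ 1 := by
      rintro rfl
      rw [orderOf_one, orderOf_eq_one_iff] at hpq
      exact hp1 hpq
    have hp2 : p.snd ≠ 0 := fun h => hp1 (PGroup.ext hp h)
    have hq2 : q.snd ≠ 0 := fun h => hq1 (PGroup.ext hq h)
    refine ⟨scale (Units.mk0 ((q.snd / p.snd) ^ 5) (pow_ne_zero _ (div_ne_zero hq2 hp2))), ?_⟩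
    rw [scale_apply]
    apply PGroup.ext
    · change _ * p.fst = _
      rw [hp, hq, mul_zero]
    · change ((q.snd / p.snd) ^ 5) ^ 3 * p.snd = q.snd
      rw [← pow_mul, F8.pow_fifteen, div_mul_cancel₀ _ hp2]
  · have hq : q.fst ≠ 0 := by rwa [Ne, hfst, ← hpq, ← hfst]
    obtain ⟨h₁, hh₁⟩ := exists_sevenNineHom_eq hε hp
    obtain ⟨h₂, hh₂⟩ := exists_sevenNineHom_eq hε hq
    obtain ⟨α, hα⟩ := exists_aut_snd_eq hε hp p.snd (sevenNineHom hε h₁ ⟨1, 0⟩).snd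
    obtain ⟨β, hβ⟩ := exists_aut_snd_eq hε hq (sevenNineHom hε h₂ ⟨1, 0⟩).snd q.snd
    refine ⟨β * sevenNineHom hε h₂ * (sevenNineHom hε h₁)⁻¹ * α, ?_⟩
    have hα' : α p = sevenNineHom hε h₁ ⟨1, 0⟩ := hα.trans (PGroup.ext hh₁.symm rfl)
    have hβ' : β (sevenNineHom hε h₂ ⟨1, 0⟩) = q :=
      Eq.trans (congrArg β (show sevenNineHom hε h₂ ⟨1, 0⟩ =
        ⟨q.fst, (sevenNineHom hε h₂ ⟨1, 0⟩).snd⟩ from PGroup.ext hh₂ rfl)) hβ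
    rw [MulAut.mul_apply, MulAut.mul_apply, MulAut.mul_apply, hα', MulAut.inv_apply_self, hβ']

end PGroup

theorem lemma4p7 (ε : F64ˣ) (hε : ∀ u : F64ˣ, u ∈ Subgroup.zpowers ε) :
    Nat.card (PGroup (ε : F64)) = 2 ^ 9 ∧
    IsATGroup (PGroup (ε : F64)) ∧
    ∃ φ : SevenNine →* MulAut (ElemAbelTwo 18),
      Nonempty (MulAut (PGroup (ε : F64)) ≃* ElemAbelTwo 18 ⋊[φ] SevenNine) := by
  have h0 := fun a => sqMap_eq_zero hε (a := a)
  refine ⟨?_, PGroup.isATGroup hε, ?_⟩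
  · rw [Nat.card_congr (PGroup.equivProd _), Nat.card_prod, F64.natCard, F8.natCard hε]
    norm_num
  · obtain ⟨e⟩ := nonempty_addEquiv_hom (F8.natCard hε)
    have hinj : Function.Injective (PGroup.sevenNineHom hε) :=
      (injective_iff_map_eq_one _).2 fun h hh => PGroup.eq_one_of_sevenNineHom_eq hε (by rw [hh]; rfl)
    let eN : (PGroup.fstHom h0).ker ≃* ElemAbelTwo 18 :=
      (PGroup.kerEquiv h0).symm.trans (AddEquiv.toMultiplicative e)
    let eH : (PGroup.sevenNineHom hε).range ≃* SevenNine := (MonoidHom.ofInjective hinj).symm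
    exact ⟨_, ⟨(SemidirectProduct.mulEquivSubgroup
      (PGroup.isComplement_ker_range hε h0)).symm.trans (SemidirectProduct.congr' eN eH)⟩⟩
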